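/- Let $n \ge 2$ and $X_n=\{0,\dots,n-1\}$. An automaton over $X_n$ is a finite set of states $Q$ with a transition function $\pi: X_n\times Q\to Q$, extended to finite words by reading letters from left to right. It is strongly synchronizing if for some $k$ the state reached after reading a word $w$ of length $k$ depends only on $w$ and not on the starting state; it is core if moreover every state is forced in this way by some word of length $k$. A (synchronous) transducer $T$ is an automaton together with an output function $\lambda: X_n\times Q\to X_n$; each state $q$ induces a map $T_q$ of $X_n^{\mathbb N}$ to itself. States of one transducer, or of two transducers, are $\omega$-equivalent if they induce the same map. A transducer is weakly minimal if distinct states are never $\omega$-equivalent, and two transducers $T,U$ are $\omega$-equal if there is a bijection $f:Q_T\to Q_U$ such that $q$ and $f(q)$ are $\omega$-equivalent for every $q$. The minimal representative of a core transducer is obtained by identifying its $\omega$-equivalent states. A transducer is invertible if $\lambda(\cdot,q)$ is a permutation of $X_n$ for every state $q$; its inverse is then obtained by switching input and output on all transitions. It is bi-synchronizing if it is invertible and both it and its inverse are strongly synchronizing. Let $\mathcal H_n$ be the group of weakly minimal, core, bi-synchronizing synchronous transducers over $X_n$, where $\omega$-equal transducers are identified. The product of $T$ and $U$ is formed by feeding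 the output of $T$ into $U$, removing the states outside the core, and identifying $\omega$-equivalent states. For an automaton $A$ with state set $Q$, let $G_A$ be the underlying unlabelled directed graph, with vertex set $Q$ and with edges the triples $(p,x,q)$ such that $\pi(x,p)=q$ (an edge from $p$ to $q$). An automorphism of $G_A$ is a pair consisting of a bijection of the vertices and a bijection of the edges that are compatible with the origin and terminus maps. For an automorphism $\phi$ of $G_A$, let $H(A,\phi)$ be the transducer with the states and transitions of $A$ that, reading $x$ in state $p$, writes the label $y$ of the image $((p)\phi,y,(q)\phi)$ of the edge $(p,x,q)$ under $\phi$, where $q=\pi(x,p)$. **Theorem.** Let $G\le \mathcal H_n$ be a finite subgroup. Then there are a core, strongly synchronizing automaton $A=A(G)$ over $X_n$, a subgroup $K$ of the automorphism group of $G_A$ (automorphisms acting on the right, so that in a product $\phi\psi$ the automorphism $\phi$ is applied first), and a group isomorphism $G\to K$, $g\mapsto\phi_g$, such that every $g\in G$ is the minimal representative of the transducer $H(A,\phi_g)$. -/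

import Mathlib

/-!
Automata and synchronous transducers over the alphabet `Fin n`, the group `Hn n` of weakly minimal,
core, bi-synchronizing, invertible, synchronous transducers (up to `ω`-equality), and the
transducers obtained from automorphisms of the directed graph underlying an automaton.
-/

noncomputable section

/-! ### Automata -/

/-- A finite automaton over the alphabet `Fin n`, with set of states `Q` and transition function
`step`. -/
structure Automaton (n : ℕ) where
  Q : Type
  [finite_Q : Finite Q]
  step : Fin n → Q → Q

attribute [instance] Automaton.finite_Q

namespace Automaton

variable {n : ℕ}

/-- The state reached from `q` after reading the word `w` from left to right. -/
def run (A : Automaton n) (w : List (Fin n)) (q : A.Q) : A.Q :=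
  w.foldl (fun p x => A.step x p) q

/-- `s` is a synchronizing map at level `k`: after reading a word `w` of length `k` from any state,
the final state is `s w`, the state forced by `w`. -/
def IsSyncMap (A : Automaton n) (k : ℕ) (s : List.Vector (Fin n) k → A.Q) : Prop :=
  ∀ (w : List.Vector (Fin n) k) (q : A.Q), A.run w.toList q = s w

def SynchronizingAt (A : Automaton n) (k : ℕ) : Prop :=
  ∃ s : List.Vector (Fin n) k → A.Q, A.IsSyncMap k s

def StronglySynchronizing (A : Automaton n) : Prop :=
  ∃ k : ℕ, A.SynchronizingAt k

/-- The states in the image of a synchronizing map. (For a nonempty alphabet this image does not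
depend on the level.) -/
def coreStates (A : Automaton n) : Set A.Q :=
  {q | ∃ (k : ℕ) (s : List.Vector (Fin n) k → A.Q), A.IsSyncMap k s ∧ q ∈ Set.range s}

/-- A strongly synchronizing automaton that is equal to its core. -/
def IsCore (A : Automaton n) : Prop :=
  A.StronglySynchronizing ∧ A.coreStates = Set.univ

theorem run_nil (A : Automaton n) (q : A.Q) : A.run [] q = q := rfl

theorem run_cons (A : Automaton n) (x : Fin n) (w : List (Fin n)) (q : A.Q) :
    A.run (x :: w) q = A.run w (A.step x q) := rfl

theorem run_append (A : Automaton n) (v w : List (Fin n)) (q : A.Q) :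
    A.run (v ++ w) q = A.run w (A.run v q) := by
  simp [run, List.foldl_append]

theorem SynchronizingAt.run_eq {A : Automaton n} {k : ℕ} (h : A.SynchronizingAt k)
    {w : List (Fin n)} (hw : w.length = k) (p q : A.Q) : A.run w p = A.run w q := by
  obtain ⟨s, hs⟩ := h
  exact (hs ⟨w, hw⟩ p).trans (hs ⟨w, hw⟩ q).symm

theorem synchronizingAt_of_run_eq {A : Automaton n} [Nonempty A.Q] {k : ℕ}
    (h : ∀ w : List (Fin n), w.length = k → ∀ p q : A.Q, A.run w p = A.run w q) :
    A.SynchronizingAt k :=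
  ⟨fun w => A.run w.toList (Classical.arbitrary _), fun w _ => h _ w.2 _ _⟩

theorem SynchronizingAt.run_eq_of_le {A : Automaton n} {k : ℕ} (h : A.SynchronizingAt k)
    {w : List (Fin n)} (hw : k ≤ w.length) (p q : A.Q) : A.run w p = A.run w q := by
  rw [← List.take_append_drop (w.length - k) w, run_append, run_append]
  exact h.run_eq (by simp; omega) _ _

theorem StronglySynchronizing.nonempty [NeZero n] {A : Automaton n}
    (h : A.StronglySynchronizing) : Nonempty A.Q := by
  obtain ⟨k, s, -⟩ := h
  exact ⟨s (List.Vector.replicate k 0)⟩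

theorem mem_coreStates {A : Automaton n} {q : A.Q} :
    q ∈ A.coreStates ↔
      ∃ w : List (Fin n), A.SynchronizingAt w.length ∧ ∀ p, A.run w p = q := by
  constructor
  · rintro ⟨k, s, hs, ⟨w, rfl⟩⟩
    refine ⟨w.toList, ?_, hs w⟩
    rw [List.Vector.toList_length]
    exact ⟨s, hs⟩
  · rintro ⟨w, ⟨s, hs⟩, hq⟩
    exact ⟨_, s, hs, ⟨w, rfl⟩, (hs ⟨w, rfl⟩ q).symm.trans (hq q)⟩

theorem step_mem_coreStates {A : Automaton n} {q : A.Q} (hq : q ∈ A.coreStates) (x : Fin n) :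
    A.step x q ∈ A.coreStates := by
  obtain ⟨w, hw, hq⟩ := mem_coreStates.1 hq
  refine mem_coreStates.2 ⟨w ++ [x], ?_, fun p => by rw [run_append, hq]; rfl⟩
  have : Nonempty A.Q := ⟨q⟩
  exact synchronizingAt_of_run_eq fun v hv p p' => hw.run_eq_of_le (by simp at hv; omega) p p'

/-- In a core automaton every state is reached from every other. -/
theorem IsCore.exists_run {A : Automaton n} (h : A.IsCore) (q : A.Q) :
    ∃ w : List (Fin n), ∀ p, A.run w p = q := by
  obtain ⟨w, -, hw⟩ := mem_coreStates.1 (h.2 ▸ Set.mem_univ q : q ∈ A.coreStates)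
  exact ⟨w, hw⟩

theorem IsCore.exists_long_run [NeZero n] {A : Automaton n} (h : A.IsCore) (q : A.Q) (k : ℕ) :
    ∃ w : List (Fin n), k ≤ w.length ∧ ∀ p, A.run w p = q := by
  obtain ⟨w, hw⟩ := h.exists_run q
  exact ⟨List.replicate k 0 ++ w, by simp, fun p => by rw [run_append, hw]⟩

theorem isCore_of_exists_long_run [NeZero n] {A : Automaton n} (h : A.StronglySynchronizing)
    (hr : ∀ (k : ℕ) (q : A.Q), ∃ (w : List (Fin n)) (p : A.Q), k ≤ w.length ∧ A.run w p = q) :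
    A.IsCore := by
  refine ⟨h, Set.eq_univ_of_forall fun q => ?_⟩
  have := h.nonempty
  obtain ⟨k, hk⟩ := h
  obtain ⟨w, p, hw, rfl⟩ := hr k q
  exact mem_coreStates.2 ⟨w, synchronizingAt_of_run_eq fun v hv p p' =>
    hk.run_eq_of_le (by omega) p p', fun p' => hk.run_eq_of_le hw p' p⟩

theorem map_run {A B : Automaton n} (f : A.Q → B.Q)
    (hf : ∀ x q, f (A.step x q) = B.step x (f q)) (w : List (Fin n)) (q : A.Q) :
    f (A.run w q) = B.run w (f q) := by
  induction w generalizing q with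
  | nil => rfl
  | cons x w ih => rw [run_cons, run_cons, ih, hf]

theorem StronglySynchronizing.of_injective {A B : Automaton n} [Nonempty A.Q] (f : A.Q → B.Q)
    (hf : ∀ x q, f (A.step x q) = B.step x (f q)) (hi : Function.Injective f)
    (h : B.StronglySynchronizing) : A.StronglySynchronizing := by
  obtain ⟨k, hk⟩ := h
  refine ⟨k, synchronizingAt_of_run_eq fun w hw p q => hi ?_⟩
  rw [map_run f hf, map_run f hf]
  exact hk.run_eq hw _ _

theorem StronglySynchronizing.of_surjective {A B : Automaton n} [Nonempty A.Q] (f : B.Q → A.Q)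
    (hf : ∀ x q, f (B.step x q) = A.step x (f q)) (hs : Function.Surjective f)
    (h : B.StronglySynchronizing) : A.StronglySynchronizing := by
  obtain ⟨k, hk⟩ := h
  refine ⟨k, synchronizingAt_of_run_eq fun w hw p q => ?_⟩
  obtain ⟨p, rfl⟩ := hs p
  obtain ⟨q, rfl⟩ := hs q
  rw [← map_run f hf, ← map_run f hf, hk.run_eq hw p q]

end Automaton

/-! ### Synchronous transducers -/

/-- A finite synchronous transducer: in state `q`, reading the letter `x`, it writes the letter
`out x q` and moves to the state `step x q`. -/
structure Transducer (n : ℕ) extends Automaton n where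
  out : Fin n → Q → Fin n

namespace Transducer

variable {n : ℕ}

/-- The state reached from `q` after reading the first `i` letters of the infinite word `x`. -/
def trace (T : Transducer n) (q : T.Q) (x : ℕ → Fin n) : ℕ → T.Q
  | 0 => q
  | i + 1 => T.step (x i) (T.trace q x i)

/-- The map on infinite words induced by the transducer with initial state `q`. -/
def act (T : Transducer n) (q : T.Q) (x : ℕ → Fin n) : ℕ → Fin n :=
  fun i => T.out (x i) (T.trace q x i)

/-- No two distinct states are `ω`-equivalent, that is, induce the same map on infinite words. -/
def WeaklyMinimal (T : Transducer n) : Prop :=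
  ∀ p q : T.Q, T.act p = T.act q → p = q

/-- `ω`-equality of transducers. -/
def OmegaEqual (T U : Transducer n) : Prop :=
  ∃ f : T.Q ≃ U.Q, ∀ q : T.Q, T.act q = U.act (f q)

/-- The product: the output of `T` is the input of `U`. -/
abbrev prod (T U : Transducer n) : Transducer n where
  Q := T.Q × U.Q
  step x pq := (T.step x pq.1, U.step (T.out x pq.1) pq.2)
  out x pq := U.out (T.out x pq.1) pq.2

/-- The transducer obtained by removing all states outside the core. -/
abbrev core (T : Transducer n) : Transducer n where
  Q := T.coreStates
  step x q := ⟨T.step x q, Automaton.step_mem_coreStates q.2 x⟩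
  out x q := T.out x q

/-- Every state acts on the alphabet as a permutation. -/
def Invertible (T : Transducer n) : Prop :=
  ∀ q : T.Q, Function.Bijective fun x => T.out x q

/-- The permutation of the alphabet induced by the state `q`. -/
def perm (T : Transducer n) (h : T.Invertible) (q : T.Q) : Equiv.Perm (Fin n) :=
  Equiv.ofBijective (fun x => T.out x q) (h q)

/-- The inverse transducer: inputs and outputs are switched on all transitions. -/
abbrev inv (T : Transducer n) (h : T.Invertible) : Transducer n where
  Q := T.Q
  step y q := T.step ((T.perm h q).symm y) q
  out y q := (T.perm h q).symm y

/-- `T` is invertible, and both `T` and its inverse are strongly synchronizing. -/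
def BiSynchronizing (T : Transducer n) : Prop :=
  ∃ h : T.Invertible, T.StronglySynchronizing ∧ (T.inv h).StronglySynchronizing

theorem trace_succ (T : Transducer n) (q : T.Q) (x : ℕ → Fin n) (i : ℕ) :
    T.trace q x (i + 1) = T.trace (T.step (x 0) q) (fun j => x (j + 1)) i := by
  induction i with
  | zero => rfl
  | succ i ih => rw [trace, ih, trace]

theorem act_zero (T : Transducer n) (q : T.Q) (x : ℕ → Fin n) : T.act q x 0 = T.out (x 0) q := rfl

theorem act_succ (T : Transducer n) (q : T.Q) (x : ℕ → Fin n) (i : ℕ) :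
    T.act q x (i + 1) = T.act (T.step (x 0) q) (fun j => x (j + 1)) i := by
  simp only [act, trace_succ]

theorem out_eq_of_act_eq {T U : Transducer n} {q : T.Q} {p : U.Q} (h : T.act q = U.act p)
    (a : Fin n) : T.out a q = U.out a p :=
  congrFun (congrFun h fun _ => a) 0

theorem act_step_eq {T U : Transducer n} {q : T.Q} {p : U.Q} (h : T.act q = U.act p)
    (a : Fin n) : T.act (T.step a q) = U.act (U.step a p) := by
  funext x i
  have := congrFun (congrFun h fun j => Nat.casesOn j a x) (i + 1)
  rwa [act_succ, act_succ] at this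

theorem act_run_eq {T U : Transducer n} {q : T.Q} {p : U.Q} (h : T.act q = U.act p)
    (w : List (Fin n)) : T.act (T.run w q) = U.act (U.run w p) := by
  induction w generalizing q p with
  | nil => exact h
  | cons a w ih => exact ih (act_step_eq h a)

/-- A relation between states that is compatible with outputs and transitions consists of pairs of
`ω`-equivalent states. -/
theorem act_eq_of_bisim {T U : Transducer n} (R : T.Q → U.Q → Prop)
    (ho : ∀ q p, R q p → ∀ a, T.out a q = U.out a p)
    (hs : ∀ q p, R q p → ∀ a, R (T.step a q) (U.step a p)) {q : T.Q} {p : U.Q} (h : R q p) :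
    T.act q = U.act p := by
  funext x i
  induction i generalizing q p x with
  | zero => exact ho q p h _
  | succ i ih => rw [act_succ, act_succ]; exact ih (hs q p h _) _

/-! #### Minimization -/

/-- `ω`-equivalence of states. -/
def stateSetoid (T : Transducer n) : Setoid T.Q where
  r p q := T.act p = T.act q
  iseqv := ⟨fun _ => rfl, fun h => h.symm, fun h h' => h.trans h'⟩

/-- The weakly minimal representative of `T`, obtained by identifying `ω`-equivalent states. -/
abbrev minimize (T : Transducer n) : Transducer n where
  Q := Quotient T.stateSetoid
  step x := Quotient.map (T.step x) fun _ _ h => act_step_eq h x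
  out x := Quotient.lift (T.out x) fun _ _ h => out_eq_of_act_eq h x

theorem minimize_act (T : Transducer n) (q : T.Q) :
    T.minimize.act (Quotient.mk T.stateSetoid q) = T.act q := by
  refine (act_eq_of_bisim (T := T) (U := T.minimize)
    (fun p r => r = Quotient.mk T.stateSetoid p) ?_ ?_ rfl).symm
  · rintro q p rfl a; rfl
  · rintro q p rfl a; rfl

theorem minimize_weaklyMinimal (T : Transducer n) : T.minimize.WeaklyMinimal := by
  intro p q
  induction p using Quotient.inductionOn
  induction q using Quotient.inductionOn
  intro h
  rw [minimize_act, minimize_act] at h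
  exact Quotient.sound h

theorem minimize_isCore [NeZero n] {T : Transducer n} (h : T.IsCore) : T.minimize.IsCore := by
  have := h.1.nonempty
  have : Nonempty T.minimize.Q := ⟨Quotient.mk T.stateSetoid (Classical.arbitrary _)⟩
  have hm : ∀ x q, Quotient.mk T.stateSetoid (T.step x q) =
      T.minimize.step x (Quotient.mk T.stateSetoid q) := fun _ _ => rfl
  refine Automaton.isCore_of_exists_long_run
    (h.1.of_surjective (A := T.minimize.toAutomaton) (Quotient.mk T.stateSetoid) hm
      Quotient.mk_surjective) fun k q => ?_
  induction q using Quotient.inductionOn with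
  | h q =>
    obtain ⟨w, hw, hq⟩ := h.exists_long_run q k
    refine ⟨w, Quotient.mk T.stateSetoid q, hw, ?_⟩
    exact (Automaton.map_run (B := T.minimize.toAutomaton) (Quotient.mk T.stateSetoid)
      hm w q).symm.trans (congrArg _ (hq q))

theorem minimize_biSynchronizing [NeZero n] {T : Transducer n} (h : T.BiSynchronizing) :
    T.minimize.BiSynchronizing := by
  obtain ⟨hi, h1, h2⟩ := h
  have := h1.nonempty
  have : Nonempty T.minimize.Q := ⟨Quotient.mk T.stateSetoid (Classical.arbitrary _)⟩
  have hi' : T.minimize.Invertible := by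
    intro q
    induction q using Quotient.inductionOn with
    | h q => exact hi q
  have : Nonempty (T.minimize.inv hi').Q := ‹Nonempty T.minimize.Q›
  refine ⟨hi', h1.of_surjective (A := T.minimize.toAutomaton) (Quotient.mk T.stateSetoid)
    (fun _ _ => rfl) Quotient.mk_surjective,
    h2.of_surjective (A := (T.minimize.inv hi').toAutomaton) (B := (T.inv hi).toAutomaton)
      (Quotient.mk T.stateSetoid)
    (fun x q => ?_) Quotient.mk_surjective⟩
  have key : T.minimize.perm hi' (Quotient.mk T.stateSetoid q) = T.perm hi q := by
    ext a; rfl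
  change Quotient.mk T.stateSetoid (T.step ((T.perm hi q).symm x) q) =
    T.minimize.step ((T.minimize.perm hi' (Quotient.mk T.stateSetoid q)).symm x)
      (Quotient.mk T.stateSetoid q)
  rw [key]
  rfl

theorem OmegaEqual.of_weaklyMinimal {T U : Transducer n} (hT : T.WeaklyMinimal)
    (hU : U.WeaklyMinimal) (h : ∀ q, ∃ p, T.act q = U.act p)
    (h' : ∀ p, ∃ q, T.act q = U.act p) : T.OmegaEqual U := by
  choose f hf using h
  refine ⟨Equiv.ofBijective f ⟨fun a b hab => hT _ _ ?_, fun p => ?_⟩, hf⟩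
  · rw [hf, hf, hab]
  · obtain ⟨q, hq⟩ := h' p
    exact ⟨q, hU _ _ ((hf q).symm.trans hq)⟩

theorem OmegaEqual.minimize_of_act_eq {T U : Transducer n} (hT : T.IsCore) (hU : U.IsCore)
    {q : T.Q} {p : U.Q} (h : T.act q = U.act p) : T.minimize.OmegaEqual U.minimize := by
  refine .of_weaklyMinimal T.minimize_weaklyMinimal U.minimize_weaklyMinimal ?_ ?_
  · intro r
    induction r using Quotient.inductionOn with
    | h r =>
      obtain ⟨w, hw⟩ := hT.exists_run r
      refine ⟨Quotient.mk U.stateSetoid (U.run w p), ?_⟩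
      rw [minimize_act, minimize_act, ← act_run_eq h, hw]
  · intro r
    induction r using Quotient.inductionOn with
    | h r =>
      obtain ⟨w, hw⟩ := hU.exists_run r
      refine ⟨Quotient.mk T.stateSetoid (T.run w q), ?_⟩
      rw [minimize_act, minimize_act, act_run_eq h, hw]

/-! #### The core, the inverse and the product -/

theorem core_act (T : Transducer n) (q : T.core.Q) : T.core.act q = T.act q.1 := by
  refine act_eq_of_bisim (T := T.core) (U := T) (fun p r => r = p.1) ?_ ?_ rfl
  · rintro q p rfl a; rfl
  · rintro q p rfl a; rfl

theorem run_mem_core [NeZero n] {T : Transducer n} (h : T.StronglySynchronizing) :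
    ∃ w : List (Fin n), ∀ q, T.run w q ∈ T.coreStates := by
  have := h.nonempty
  obtain ⟨k, hk⟩ := h
  have hl : (List.replicate k (0 : Fin n)).length = k := by simp
  refine ⟨List.replicate k 0, fun q => Automaton.mem_coreStates.2 ⟨List.replicate k 0, ?_, ?_⟩⟩
  · rwa [hl]
  · exact fun p => hk.run_eq hl p q

theorem core_nonempty [NeZero n] {T : Transducer n} (h : T.StronglySynchronizing) :
    Nonempty T.core.Q := by
  obtain ⟨w, hw⟩ := run_mem_core h
  obtain ⟨q⟩ := h.nonempty
  exact ⟨⟨_, hw q⟩⟩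

theorem core_isCore [NeZero n] {T : Transducer n} (h : T.StronglySynchronizing) :
    T.core.IsCore := by
  have := core_nonempty h
  have hm : ∀ x (q : T.core.Q), (T.core.step x q).1 = T.step x q.1 := fun _ _ => rfl
  refine Automaton.isCore_of_exists_long_run
    (h.of_injective (A := T.core.toAutomaton) Subtype.val hm Subtype.val_injective) fun k q => ?_
  obtain ⟨w, -, hw⟩ := Automaton.mem_coreStates.1 q.2
  refine ⟨List.replicate k 0 ++ w, q, by simp, Subtype.ext ?_⟩
  rw [Automaton.map_run (A := T.core.toAutomaton) (B := T.toAutomaton) Subtype.val hm,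
    Automaton.run_append, hw]

theorem core_biSynchronizing [NeZero n] {T : Transducer n} (h : T.BiSynchronizing) :
    T.core.BiSynchronizing := by
  obtain ⟨hi, h1, h2⟩ := h
  have := core_nonempty h1
  have hi' : T.core.Invertible := fun q => hi q.1
  have : Nonempty (T.core.inv hi').Q := ‹Nonempty T.core.Q›
  refine ⟨hi', (core_isCore h1).1, h2.of_injective (A := (T.core.inv hi').toAutomaton)
    (B := (T.inv hi).toAutomaton) (fun q : T.core.Q => q.1) (fun x q => ?_) Subtype.val_injective⟩
  rfl

theorem inv_invertible (T : Transducer n) (h : T.Invertible) : (T.inv h).Invertible :=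
  fun q => (T.perm h q).symm.bijective

theorem inv_perm (T : Transducer n) (h : T.Invertible) (q : T.Q) :
    (T.inv h).perm (T.inv_invertible h) q = (T.perm h q).symm := by
  ext a; rfl

theorem inv_step_out (T : Transducer n) (h : T.Invertible) (x : Fin n) (q : T.Q) :
    (T.inv h).step (T.out x q) q = T.step x q := by
  change T.step ((T.perm h q).symm (T.perm h q x)) q = _
  rw [Equiv.symm_apply_apply]

theorem inv_inv_step (T : Transducer n) (h : T.Invertible) (x : Fin n) (q : T.Q) :
    ((T.inv h).inv (T.inv_invertible h)).step x q = T.step x q := by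
  change (T.inv h).step (((T.inv h).perm _ q).symm x) q = _
  rw [inv_perm]
  exact T.inv_step_out h x q

/-- The word written by `T` while reading a word from the state `q`. -/
def outWord (T : Transducer n) : List (Fin n) → T.Q → List (Fin n)
  | [], _ => []
  | x :: w, q => T.out x q :: T.outWord w (T.step x q)

theorem length_outWord (T : Transducer n) (w : List (Fin n)) (q : T.Q) :
    (T.outWord w q).length = w.length := by
  induction w generalizing q with
  | nil => rfl
  | cons x w ih => simp [outWord, ih]

theorem inv_run_outWord (T : Transducer n) (h : T.Invertible) (w : List (Fin n)) (q : T.Q) :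
    (T.inv h).run (T.outWord w q) q = T.run w q := by
  induction w generalizing q with
  | nil => rfl
  | cons x w ih =>
    rw [outWord, Automaton.run_cons, inv_step_out, ih, Automaton.run_cons]

theorem inv_isCore [NeZero n] {T : Transducer n} (hc : T.IsCore) (hi : T.Invertible)
    (h : (T.inv hi).StronglySynchronizing) : (T.inv hi).IsCore := by
  refine Automaton.isCore_of_exists_long_run h fun k q => ?_
  obtain ⟨w, hw, hq⟩ := hc.exists_long_run (q : T.Q) k
  exact ⟨T.outWord w q, q, by rwa [length_outWord], (T.inv_run_outWord hi w q).trans (hq q)⟩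

theorem inv_biSynchronizing [NeZero n] {T : Transducer n} (hi : T.Invertible)
    (h1 : T.StronglySynchronizing) (h2 : (T.inv hi).StronglySynchronizing) :
    (T.inv hi).BiSynchronizing := by
  have : Nonempty ((T.inv hi).inv (T.inv_invertible hi)).Q := h1.nonempty
  exact ⟨T.inv_invertible hi, h2, h1.of_injective
    (A := ((T.inv hi).inv (T.inv_invertible hi)).toAutomaton) (fun q : T.Q => q)
    (fun x q => T.inv_inv_step hi x q) Function.injective_id⟩

theorem prod_run (T U : Transducer n) (w : List (Fin n)) (p : T.Q) (q : U.Q) :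
    (T.prod U).run w (p, q) = (T.run w p, U.run (T.outWord w p) q) := by
  induction w generalizing p q with
  | nil => rfl
  | cons x w ih => exact ih _ _

theorem prod_act (T U : Transducer n) (p : T.Q) (q : U.Q) (x : ℕ → Fin n) :
    (T.prod U).act (p, q) x = U.act q (T.act p x) := by
  funext i
  induction i generalizing p q x with
  | zero => rfl
  | succ i ih =>
    rw [act_succ, act_succ]
    exact (ih _ _ _).trans (by congr 1; funext j; exact (T.act_succ p x j).symm)

theorem prod_stronglySynchronizing [NeZero n] {T U : Transducer n}
    (hT : T.StronglySynchronizing) (hU : U.StronglySynchronizing) :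
    (T.prod U).StronglySynchronizing := by
  have : Nonempty (T.prod U).Q := by
    obtain ⟨p⟩ := hT.nonempty
    obtain ⟨q⟩ := hU.nonempty
    exact ⟨(p, q)⟩
  obtain ⟨j, hj⟩ := hT
  obtain ⟨k, hk⟩ := hU
  refine ⟨j + k, Automaton.synchronizingAt_of_run_eq ?_⟩
  rintro w hw ⟨p, q⟩ ⟨p', q'⟩
  rw [← List.take_append_drop j w, Automaton.run_append, Automaton.run_append,
    prod_run, prod_run, prod_run, prod_run]
  have hl : (w.take j).length = j := by simp; omega
  rw [hj.run_eq hl p p']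
  refine Prod.ext rfl (hk.run_eq ?_ _ _)
  rw [length_outWord]; simp; omega

theorem prod_invertible {T U : Transducer n} (hT : T.Invertible) (hU : U.Invertible) :
    (T.prod U).Invertible :=
  fun q => (hU q.2).comp (hT q.1)

theorem prod_biSynchronizing [NeZero n] {T U : Transducer n} (hT : T.BiSynchronizing)
    (hU : U.BiSynchronizing) : (T.prod U).BiSynchronizing := by
  obtain ⟨hTi, hT1, hT2⟩ := hT
  obtain ⟨hUi, hU1, hU2⟩ := hU
  have h1 := prod_stronglySynchronizing hT1 hU1
  have : Nonempty ((T.prod U).inv (prod_invertible hTi hUi)).Q := h1.nonempty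
  refine ⟨prod_invertible hTi hUi, h1, (prod_stronglySynchronizing hU2 hT2).of_injective
    (A := ((T.prod U).inv (prod_invertible hTi hUi)).toAutomaton)
    (fun q : T.Q × U.Q => (q.2, q.1)) (fun z q => ?_) Prod.swap_injective⟩
  have key : ((T.prod U).perm (prod_invertible hTi hUi) q).symm z =
      (T.perm hTi q.1).symm ((U.perm hUi q.2).symm z) := by
    rw [Equiv.symm_apply_eq]
    change z = U.perm hUi q.2 (T.perm hTi q.1 _)
    simp
  change Prod.mk (U.step (T.out (((T.prod U).perm (prod_invertible hTi hUi) q).symm z) q.1) q.2)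
    (T.step (((T.prod U).perm (prod_invertible hTi hUi) q).symm z) q.1) =
    (U.step ((U.perm hUi q.2).symm z) q.2,
      T.step ((T.perm hTi q.1).symm ((U.perm hUi q.2).symm z)) q.1)
  rw [key]
  congr 2
  exact (T.perm hTi q.1).apply_symm_apply _

theorem inv_act_act (T : Transducer n) (h : T.Invertible) (q : T.Q) (x : ℕ → Fin n) :
    T.act q ((T.inv h).act q x) = x := by
  funext i
  induction i generalizing q x with
  | zero => exact (T.perm h q).apply_symm_apply (x 0)
  | succ i ih =>
    rw [act_succ]
    refine Eq.trans ?_ (ih ((T.inv h).step (x 0) q) (fun j => x (j + 1)))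
    congr 1
    funext j
    exact (T.inv h).act_succ q x j

/-- The transducer with a single state, which copies its input. -/
abbrev identity (n : ℕ) : Transducer n where
  Q := Unit
  step _ q := q
  out x _ := x

theorem identity_act (q : (identity n).Q) (x : ℕ → Fin n) : (identity n).act q x = x := rfl

theorem identity_isCore [NeZero n] : (identity n).IsCore :=
  Automaton.isCore_of_exists_long_run ⟨0, fun _ => (), fun _ _ => rfl⟩
    fun k _ => ⟨List.replicate k 0, (), by simp, rfl⟩

theorem identity_biSynchronizing : (identity n).BiSynchronizing :=
  ⟨fun _ => Function.bijective_id, ⟨0, fun _ => (), fun _ _ => rfl⟩,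
    ⟨0, fun _ => (), fun _ _ => rfl⟩⟩

end Transducer

/-! ### The group `Hn n` -/

/-- The weakly minimal, core, bi-synchronizing (in particular invertible) transducers. -/
def HnTransducer (n : ℕ) : Type 1 :=
  {T : Transducer n // T.WeaklyMinimal ∧ T.IsCore ∧ T.BiSynchronizing}

instance HnTransducer.instSetoid (n : ℕ) : Setoid (HnTransducer n) where
  r T U := T.1.OmegaEqual U.1
  iseqv := by
    refine ⟨fun T => ⟨Equiv.refl _, fun _ => rfl⟩, ?_, ?_⟩
    · rintro T U ⟨f, hf⟩
      exact ⟨f.symm, fun q => by rw [hf, Equiv.apply_symm_apply]⟩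
    · rintro T U V ⟨f, hf⟩ ⟨g, hg⟩
      exact ⟨f.trans g, fun q => (hf q).trans (hg _)⟩

/-- Weakly minimal, core, bi-synchronizing, synchronous transducers over `Fin n`, where
`ω`-equal transducers are identified. -/
def Hn (n : ℕ) : Type 1 := Quotient (HnTransducer.instSetoid n)

namespace Hn

variable {n : ℕ} [NeZero n]

/-- The element of `Hn n` given by the minimal representative of a core, bi-synchronizing
transducer. -/
def minimalRep (T : Transducer n) (hc : T.IsCore) (hb : T.BiSynchronizing) : Hn n :=
  Quotient.mk _ ⟨T.minimize, T.minimize_weaklyMinimal, Transducer.minimize_isCore hc,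
    Transducer.minimize_biSynchronizing hb⟩

theorem minimalRep_eq {T U : Transducer n} {hc : T.IsCore} {hb : T.BiSynchronizing}
    {hc' : U.IsCore} {hb' : U.BiSynchronizing} {q : T.Q} {p : U.Q} (h : T.act q = U.act p) :
    minimalRep T hc hb = minimalRep U hc' hb' :=
  Quotient.sound (Transducer.OmegaEqual.minimize_of_act_eq hc hc' h)

theorem mk_eq_minimalRep (T : HnTransducer n) :
    (Quotient.mk _ T : Hn n) = minimalRep T.1 T.2.2.1 T.2.2.2 := by
  refine Quotient.sound (Transducer.OmegaEqual.of_weaklyMinimal T.2.1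
    T.1.minimize_weaklyMinimal (fun q => ⟨Quotient.mk T.1.stateSetoid q, ?_⟩) fun p => ?_)
  · exact (T.1.minimize_act q).symm
  · induction p using Quotient.inductionOn with
    | h p => exact ⟨p, (T.1.minimize_act p).symm⟩

theorem exists_eq_minimalRep (a : Hn n) :
    ∃ (T : Transducer n) (hc : T.IsCore) (hb : T.BiSynchronizing), a = minimalRep T hc hb := by
  induction a using Quotient.inductionOn with
  | h T => exact ⟨_, _, _, mk_eq_minimalRep T⟩

/-- The minimal representative of the core of the product of two transducers. -/
def mulAux (T U : Transducer n) (hT : T.BiSynchronizing) (hU : U.BiSynchronizing) : Hn n :=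
  minimalRep (T.prod U).core
    (Transducer.core_isCore (Transducer.prod_biSynchronizing hT hU).choose_spec.1)
    (Transducer.core_biSynchronizing (Transducer.prod_biSynchronizing hT hU))

theorem minimalRep_core_eq {S S' : Transducer n} (hS : S.BiSynchronizing)
    (hc' : S'.IsCore) (hb' : S'.BiSynchronizing) {hc : S.core.IsCore}
    {hb : S.core.BiSynchronizing} {q : S.Q} {p : S'.Q} (h : S.act q = S'.act p) :
    minimalRep S.core hc hb = minimalRep S' hc' hb' := by
  obtain ⟨w, hw⟩ := Transducer.run_mem_core hS.choose_spec.1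
  refine minimalRep_eq (q := ⟨S.run w q, hw q⟩) (p := S'.run w p) ?_
  rw [Transducer.core_act]
  exact Transducer.act_run_eq h w

theorem mulAux_eq {T U T' U' : Transducer n} {hT : T.BiSynchronizing} {hU : U.BiSynchronizing}
    {hT' : T'.BiSynchronizing} {hU' : U'.BiSynchronizing} {p : T.Q} {q : U.Q} {p' : T'.Q}
    {q' : U'.Q} (hp : T.act p = T'.act p') (hq : U.act q = U'.act q') :
    mulAux T U hT hU = mulAux T' U' hT' hU' := by
  obtain ⟨w, hw⟩ := Transducer.run_mem_core
    (Transducer.prod_biSynchronizing hT' hU').choose_spec.1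
  have h : (T.prod U).act (p, q) = (T'.prod U').act (p', q') := by
    funext x
    rw [Transducer.prod_act, Transducer.prod_act, hp, hq]
  refine minimalRep_core_eq (Transducer.prod_biSynchronizing hT hU) _ _
    (q := (T.prod U).run w (p, q)) (p := ⟨_, hw (p', q')⟩) ?_
  rw [Transducer.core_act]
  exact Transducer.act_run_eq h w

/-- The product of two transducers is formed by taking their product as transducers (the left
factor acts first), removing non-core states, and identifying `ω`-equivalent states. -/
instance : Mul (Hn n) where
  mul := Quotient.lift₂ (fun T U => mulAux T.1 U.1 T.2.2.2 U.2.2.2) (by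
    rintro T U T' U' ⟨f, hf⟩ ⟨g, hg⟩
    obtain ⟨p⟩ := T.2.2.1.1.nonempty
    obtain ⟨q⟩ := U.2.2.1.1.nonempty
    exact mulAux_eq (hf p) (hg q))

instance : One (Hn n) where
  one := minimalRep (Transducer.identity n) Transducer.identity_isCore
    Transducer.identity_biSynchronizing

/-- The minimal representative of the inverse transducer. -/
def invAux (T : Transducer n) (hc : T.IsCore) (hb : T.BiSynchronizing) : Hn n :=
  minimalRep (T.inv hb.choose)
    (Transducer.inv_isCore hc hb.choose hb.choose_spec.2)
    (Transducer.inv_biSynchronizing hb.choose hb.choose_spec.1 hb.choose_spec.2)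

theorem invAux_eq {T U : Transducer n} {hc : T.IsCore} {hb : T.BiSynchronizing}
    {hc' : U.IsCore} {hb' : U.BiSynchronizing} {q : T.Q} {p : U.Q} (h : T.act q = U.act p) :
    invAux T hc hb = invAux U hc' hb' := by
  refine minimalRep_eq (q := q) (p := p) (Transducer.act_eq_of_bisim
    (T := T.inv hb.choose) (U := U.inv hb'.choose)
    (fun (q : T.Q) (p : U.Q) => T.act q = U.act p) ?_ ?_ h)
  all_goals
    intro q p h a
    have hp : T.perm hb.choose q = U.perm hb'.choose p := by
      ext b
      exact congrArg Fin.val (Transducer.out_eq_of_act_eq h b)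
  · change (T.perm hb.choose q).symm a = (U.perm hb'.choose p).symm a
    rw [hp]
  · change T.act (T.step ((T.perm hb.choose q).symm a) q) =
      U.act (U.step ((U.perm hb'.choose p).symm a) p)
    rw [hp]
    exact Transducer.act_step_eq h _

instance : Inv (Hn n) where
  inv := Quotient.lift (fun T => invAux T.1 T.2.2.1 T.2.2.2) (by
    rintro T T' ⟨f, hf⟩
    obtain ⟨p⟩ := T.2.2.1.1.nonempty
    exact invAux_eq (hf p))

theorem minimalRep_mul {T U : Transducer n} {hc : T.IsCore} {hb : T.BiSynchronizing}
    {hc' : U.IsCore} {hb' : U.BiSynchronizing} :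
    minimalRep T hc hb * minimalRep U hc' hb' = mulAux T U hb hb' := by
  obtain ⟨p⟩ := hc.1.nonempty
  obtain ⟨q⟩ := hc'.1.nonempty
  exact mulAux_eq (hT := Transducer.minimize_biSynchronizing hb)
    (hU := Transducer.minimize_biSynchronizing hb') (T.minimize_act p) (U.minimize_act q)

theorem minimalRep_inv {T : Transducer n} {hc : T.IsCore} {hb : T.BiSynchronizing} :
    (minimalRep T hc hb)⁻¹ = invAux T hc hb := by
  obtain ⟨p⟩ := hc.1.nonempty
  exact invAux_eq (hc := Transducer.minimize_isCore hc)
    (hb := Transducer.minimize_biSynchronizing hb) (T.minimize_act p)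

/-- The product of two elements is determined by any pair of states. -/
theorem minimalRep_mul_eq {T U V : Transducer n} {hc : T.IsCore} {hb : T.BiSynchronizing}
    {hc' : U.IsCore} {hb' : U.BiSynchronizing} {hc'' : V.IsCore} {hb'' : V.BiSynchronizing}
    {p : T.Q} {q : U.Q} {r : V.Q} (h : ∀ x, U.act q (T.act p x) = V.act r x) :
    minimalRep T hc hb * minimalRep U hc' hb' = minimalRep V hc'' hb'' := by
  rw [minimalRep_mul]
  refine minimalRep_core_eq (Transducer.prod_biSynchronizing hb hb') hc'' hb''
    (q := (p, q)) (p := r) ?_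
  funext x
  rw [Transducer.prod_act, h]

instance : Group (Hn n) :=
  Group.ofLeftAxioms
    (by
      intro a b c
      obtain ⟨T, hT, hT', rfl⟩ := exists_eq_minimalRep a
      obtain ⟨U, hU, hU', rfl⟩ := exists_eq_minimalRep b
      obtain ⟨V, hV, hV', rfl⟩ := exists_eq_minimalRep c
      have key : ∀ (S : Transducer n) (hS : S.BiSynchronizing) (R : Transducer n)
          (hR : R.BiSynchronizing) (t : T.Q) (u : U.Q) (v : V.Q) (s : S.Q) (r : R.Q),
          (∀ x, S.act s x = U.act u (T.act t x)) → (∀ x, R.act r x = V.act v (U.act u x)) →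
          mulAux S V hS hV' = mulAux T R hT' hR := by
        intro S hS R hR t u v s r h1 h2
        have hb := Transducer.prod_biSynchronizing hT' hR
        obtain ⟨w, hw⟩ := Transducer.run_mem_core hb.choose_spec.1
        have h : (S.prod V).act (s, v) = (T.prod R).act (t, r) := by
          funext x
          rw [Transducer.prod_act, Transducer.prod_act, h1, h2]
        refine minimalRep_core_eq (Transducer.prod_biSynchronizing hS hV') _ _
          (q := (S.prod V).run w (s, v)) (p := ⟨_, hw (t, r)⟩) ?_
        rw [Transducer.core_act]
        exact Transducer.act_run_eq h w
      -- choose a core state of `T * U`, and a state of the core of `U * V` matching it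
      have hb1 := Transducer.prod_biSynchronizing hT' hU'
      have hb2 := Transducer.prod_biSynchronizing hU' hV'
      obtain ⟨t⟩ := hT.1.nonempty
      obtain ⟨u⟩ := hU.1.nonempty
      obtain ⟨v⟩ := hV.1.nonempty
      have e1 : minimalRep T hT hT' * minimalRep U hU hU' * minimalRep V hV hV' =
          mulAux (T.prod U) V hb1 hV' := by
        rw [minimalRep_mul, mulAux, minimalRep_mul]
        obtain ⟨r⟩ := Transducer.core_nonempty hb1.choose_spec.1
        exact mulAux_eq (Transducer.core_act _ r) (rfl : V.act v = V.act v)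
      have e2 : minimalRep T hT hT' * (minimalRep U hU hU' * minimalRep V hV hV') =
          mulAux T (U.prod V) hT' hb2 := by
        rw [minimalRep_mul, mulAux, minimalRep_mul]
        obtain ⟨r⟩ := Transducer.core_nonempty hb2.choose_spec.1
        exact mulAux_eq (rfl : T.act t = T.act t) (Transducer.core_act _ r)
      rw [e1, e2]
      exact key _ _ _ _ t u v (t, u) (u, v) (fun x => Transducer.prod_act T U t u x)
        fun x => Transducer.prod_act U V u v x)
    (by
      intro a
      obtain ⟨T, hT, hT', rfl⟩ := exists_eq_minimalRep a
      obtain ⟨t⟩ := hT.1.nonempty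
      exact minimalRep_mul_eq (p := ()) (q := t) (r := t) fun x => rfl)
    (by
      intro a
      obtain ⟨T, hT, hT', rfl⟩ := exists_eq_minimalRep a
      obtain ⟨t⟩ := hT.1.nonempty
      rw [minimalRep_inv]
      exact minimalRep_mul_eq (p := t) (q := t) (r := ()) fun x => T.inv_act_act _ t x)

end Hn

/-! ### Directed graphs and their automorphisms -/

/-- A directed graph; loops and multiple edges are allowed. -/
structure DirectedGraph where
  V : Type
  E : Type
  origin : E → V
  terminus : E → V

namespace DirectedGraph

/-- An automorphism of a directed graph: a bijection of the vertices together with a compatible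
bijection of the edges. -/
@[ext]
structure Automorphism (Γ : DirectedGraph) where
  vert : Equiv.Perm Γ.V
  edge : Equiv.Perm Γ.E
  origin_edge : ∀ e, Γ.origin (edge e) = vert (Γ.origin e)
  terminus_edge : ∀ e, Γ.terminus (edge e) = vert (Γ.terminus e)

/-- Automorphisms act on the right: in a product the left factor is applied first. -/
instance (Γ : DirectedGraph) : Group Γ.Automorphism where
  mul φ ψ :=
    { vert := φ.vert.trans ψ.vert
      edge := φ.edge.trans ψ.edge
      origin_edge := fun e => by simp [φ.origin_edge, ψ.origin_edge]
      terminus_edge := fun e => by simp [φ.terminus_edge, ψ.terminus_edge] }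
  one :=
    { vert := Equiv.refl _
      edge := Equiv.refl _
      origin_edge := fun _ => rfl
      terminus_edge := fun _ => rfl }
  inv φ :=
    { vert := φ.vert.symm
      edge := φ.edge.symm
      origin_edge := fun e => by
        rw [Equiv.eq_symm_apply, ← φ.origin_edge, Equiv.apply_symm_apply]
      terminus_edge := fun e => by
        rw [Equiv.eq_symm_apply, ← φ.terminus_edge, Equiv.apply_symm_apply] }
  mul_assoc _ _ _ := rfl
  one_mul _ := rfl
  mul_one _ := rfl
  inv_mul_cancel φ := Automorphism.ext (Equiv.symm_trans_self φ.vert)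
    (Equiv.symm_trans_self φ.edge)

end DirectedGraph

namespace Automaton

variable {n : ℕ}

/-- The unlabelled directed graph underlying an automaton: its vertices are the states, and its
edges are the triples `(p, x, q)` with `step x p = q`. -/
abbrev digraph (A : Automaton n) : DirectedGraph where
  V := A.Q
  E := {e : A.Q × Fin n × A.Q // A.step e.2.1 e.1 = e.2.2}
  origin e := e.1.1
  terminus e := e.1.2.2

/-- The transducer `H(A, φ)`: it has the states and transitions of `A`, and reading `x` in the
state `p` it writes the label of the image under `φ` of the edge leaving `p` with label `x`. -/
abbrev glue (A : Automaton n) (φ : A.digraph.Automorphism) : Transducer n where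
  Q := A.Q
  step := A.step
  out x p := (φ.edge ⟨(p, x, A.step x p), rfl⟩).1.2.1

theorem edge_eq (A : Automaton n) (φ : A.digraph.Automorphism) (x : Fin n) (p : A.Q) :
    (φ.edge ⟨(p, x, A.step x p), rfl⟩).1 =
      (φ.vert p, (A.glue φ).out x p, φ.vert (A.step x p)) :=
  Prod.ext (φ.origin_edge _) (Prod.ext rfl (φ.terminus_edge _))

theorem glue_step (A : Automaton n) (φ : A.digraph.Automorphism) (x : Fin n) (p : A.Q) :
    A.step ((A.glue φ).out x p) (φ.vert p) = φ.vert (A.step x p) := by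
  have h := (φ.edge ⟨(p, x, A.step x p), rfl⟩).2
  rwa [edge_eq] at h

theorem glue_invertible (A : Automaton n) (φ : A.digraph.Automorphism) :
    (A.glue φ).Invertible := by
  intro p
  refine Finite.injective_iff_bijective.1 fun x y hxy => ?_
  have hxy' : (A.glue φ).out x p = (A.glue φ).out y p := hxy
  have h : φ.edge ⟨(p, x, A.step x p), rfl⟩ = φ.edge ⟨(p, y, A.step y p), rfl⟩ := by
    apply Subtype.ext
    rw [edge_eq, edge_eq, ← glue_step, ← glue_step, hxy']
  have h' := congrArg (fun e : A.digraph.E => e.1.2.1) (φ.edge.injective h)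
  exact h'

theorem glue_biSynchronizing [NeZero n] {A : Automaton n} (hA : A.StronglySynchronizing)
    (φ : A.digraph.Automorphism) : (A.glue φ).BiSynchronizing := by
  have : Nonempty ((A.glue φ).inv (A.glue_invertible φ)).Q := hA.nonempty
  refine ⟨A.glue_invertible φ, hA, hA.of_injective
    (A := ((A.glue φ).inv (A.glue_invertible φ)).toAutomaton) (fun q : A.Q => φ.vert q)
    (fun y q => ?_) φ.vert.injective⟩
  change φ.vert (A.step (((A.glue φ).perm (A.glue_invertible φ) q).symm y) q) =
    A.step y (φ.vert q)
  rw [← glue_step]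
  congr 1
  exact ((A.glue φ).perm (A.glue_invertible φ) q).apply_symm_apply y

end Automaton

/-- The minimal representative of the transducer `H(A, φ)`, for a core strongly synchronizing
automaton `A` and an automorphism `φ` of its underlying directed graph. -/
def Hn.ofGraphAutomorphism {n : ℕ} [NeZero n] (A : Automaton n) (hA : A.IsCore)
    (φ : A.digraph.Automorphism) : Hn n :=
  Hn.minimalRep (A.glue φ) hA (Automaton.glue_biSynchronizing hA.1 φ)

end

/-! ### Uniform synchronization, and equality in `Hn n` read off from states -/

noncomputable section

/-! Choose a weakly minimal representative `T g` for each element `g` of the finite group, and let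
all of them read the same input. A state `s` of the resulting automaton is a family of states `s g`,
and `A` is the core of this automaton; finiteness of the group makes it finite and strongly
synchronizing.

An element `h` moves the state reached after an input to the state reached after the image of that
input under `T h`. Since `T h` followed by `T g` represents `h * g`, the image `t` of `s` should
satisfy: `T h` from `s h`, followed by `T g` from `t g`, is the map of `T (h * g)` from `s (h * g)`.
Such a `t` exists by synchronization (`exists_isTranslate`) and is unique by weak minimality
(`IsTranslate.unique`). Uniqueness turns the translates into a right action compatible with
transitions (`vert_vert`, `vert_step`). Sending the label `a` of an edge leaving `s` to the output
of `T h` at `s h` extends the action to edges.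

In `H(A, φ_h)` the state `s` thus behaves exactly like `s h` in `T h`, so the minimal representative
is `h` (`eq_ofGraphAutomorphism`). In particular `φ_h` determines `h`, and the action is faithful.
-/

theorem Automaton.exists_uniform_level {n : ℕ} {J : Type*} [Finite J] {B : J → Automaton n}
    (h : ∀ j, (B j).StronglySynchronizing) :
    ∃ k : ℕ, ∀ (j : J) (w : List (Fin n)), k ≤ w.length →
      ∀ p q, (B j).run w p = (B j).run w q := by
  choose l hl using h
  obtain ⟨k, hk⟩ := (Set.finite_range l).bddAbove
  exact ⟨k, fun j w hw => (hl j).run_eq_of_le ((hk ⟨j, rfl⟩).trans hw)⟩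

theorem Automaton.mem_coreStates_of_run {n : ℕ} {A : Automaton n} {k : ℕ}
    (h : ∀ w : List (Fin n), k ≤ w.length → ∀ p q, A.run w p = A.run w q)
    {w : List (Fin n)} (hw : k ≤ w.length) (q : A.Q) : A.run w q ∈ A.coreStates := by
  have : Nonempty A.Q := ⟨q⟩
  exact Automaton.mem_coreStates.2 ⟨w, Automaton.synchronizingAt_of_run_eq
    fun v hv => h v (by omega), fun p => h w hw p q⟩

theorem Hn.exists_act_eq {n : ℕ} [NeZero n] {T U : Transducer n} {hc : T.IsCore}
    {hb : T.BiSynchronizing} {hc' : U.IsCore} {hb' : U.BiSynchronizing}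
    (h : minimalRep T hc hb = minimalRep U hc' hb') (q : T.Q) :
    ∃ p : U.Q, T.act q = U.act p := by
  obtain ⟨f, hf⟩ : T.minimize.OmegaEqual U.minimize := Quotient.exact h
  obtain ⟨p, hp⟩ := Quotient.exists_rep (f (Quotient.mk T.stateSetoid q))
  refine ⟨p, ?_⟩
  rw [← T.minimize_act, hf, ← hp, U.minimize_act]

/-- Multiplication in `Hn n` passes to the core and minimizes, and neither operation changes the map
induced by a surviving state. -/
theorem Hn.exists_prod_act_eq {n : ℕ} [NeZero n] {T U V : Transducer n} {hc : T.IsCore}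
    {hb : T.BiSynchronizing} {hc' : U.IsCore} {hb' : U.BiSynchronizing} {hc'' : V.IsCore}
    {hb'' : V.BiSynchronizing}
    (h : minimalRep V hc'' hb'' = minimalRep T hc hb * minimalRep U hc' hb') (r : V.Q) :
    ∃ p : (T.prod U).Q, V.act r = (T.prod U).act p := by
  rw [minimalRep_mul] at h
  obtain ⟨p, hp⟩ := exists_act_eq h r
  exact ⟨p.1, hp.trans (Transducer.core_act _ p)⟩

/-! ### The diagonal transducer and translates of its states -/

namespace Transducer

variable {n : ℕ} {I : Type}

theorem act_surjective {T : Transducer n} (h : T.Invertible) (q : T.Q) :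
    Function.Surjective (T.act q) :=
  fun x => ⟨_, T.inv_act_act h q x⟩

/-- The transducer which copies its input, and whose states record the states reached in all
transducers of a family when they read this input. -/
abbrev diagonal [Finite I] (T : I → Transducer n) : Transducer n where
  Q := ∀ i, (T i).Q
  step a s i := (T i).step a (s i)
  out a _ := a

theorem diagonal_run [Finite I] (T : I → Transducer n) (w : List (Fin n)) (s : ∀ i, (T i).Q)
    (i : I) : (diagonal T).run w s i = (T i).run w (s i) :=
  Automaton.map_run (A := (diagonal T).toAutomaton) (B := (T i).toAutomaton)
    (fun s => s i) (fun _ _ => rfl) w s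

theorem diagonal_stronglySynchronizing [NeZero n] [Finite I] {T : I → Transducer n}
    (h : ∀ i, (T i).StronglySynchronizing) : (diagonal T).StronglySynchronizing := by
  obtain ⟨k, hk⟩ := Automaton.exists_uniform_level h
  have : Nonempty (diagonal T).Q := ⟨fun i => (h i).nonempty.some⟩
  refine ⟨k, Automaton.synchronizingAt_of_run_eq fun w hw p q => funext fun i => ?_⟩
  rw [diagonal_run, diagonal_run]
  exact hk i w hw.ge _ _

/-- If `s` lists the states reached in the transducers of a family after some input, then `t` lists
the states reached after the image of this input under the transducer with index `h`. -/
def IsTranslate [Mul I] (T : I → Transducer n) (h : I) (s t : ∀ i, (T i).Q) : Prop :=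
  ∀ g x, (T g).act (t g) ((T h).act (s h) x) = (T (h * g)).act (s (h * g)) x

namespace IsTranslate

/-- Every infinite word is an output of the invertible `T h` from `s h`, so the defining identity
prescribes the whole map induced by `t g`; weak minimality then recovers the state. -/
theorem unique [Mul I] {T : I → Transducer n} (hm : ∀ i, (T i).WeaklyMinimal)
    (hi : ∀ i, (T i).Invertible) {h : I} {s t t' : ∀ i, (T i).Q}
    (ht : IsTranslate T h s t) (ht' : IsTranslate T h s t') : t = t' := by
  funext g
  refine hm g _ _ (funext fun y => ?_)
  obtain ⟨x, rfl⟩ := act_surjective (hi h) (s h) y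
  rw [ht, ht']

theorem out_eq [Mul I] {T : I → Transducer n} {h : I} {s t : ∀ i, (T i).Q}
    (ht : IsTranslate T h s t) (g : I) (a : Fin n) :
    (T g).out ((T h).out a (s h)) (t g) = (T (h * g)).out a (s (h * g)) :=
  congrFun (ht g fun _ => a) 0

/-- The defining identity says that the state `(s h, t g)` of the product is `ω`-equivalent to `s (h
* g)`, and `ω`-equivalence passes to successors. -/
theorem step [Mul I] {T : I → Transducer n} {h : I} {s t : ∀ i, (T i).Q}
    (ht : IsTranslate T h s t) (a : Fin n) :
    IsTranslate T h (fun i => (T i).step a (s i))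
      (fun i => (T i).step ((T h).out a (s h)) (t i)) := by
  intro g x
  have e : ((T h).prod (T g)).act (s h, t g) = (T (h * g)).act (s (h * g)) :=
    funext fun x => (prod_act _ _ _ _ x).trans (ht g x)
  exact (prod_act _ _ _ _ x).symm.trans (congrFun (act_step_eq e a) x)

theorem trans [Semigroup I] {T : I → Transducer n} {h k : I} {s t u : ∀ i, (T i).Q}
    (ht : IsTranslate T h s t) (hu : IsTranslate T k t u) : IsTranslate T (h * k) s u := by
  intro g x
  rw [← ht, hu, ht]
  -- The type of `s i` depends on `i`, so the index is changed in the transducer and the state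
  -- simultaneously.
  exact congrArg (fun i => (T i).act (s i) x) (mul_assoc h k g).symm

theorem one [Monoid I] {T : I → Transducer n} {s : ∀ i, (T i).Q}
    (hs : ∀ x, (T 1).act (s 1) x = x) : IsTranslate T 1 s s := by
  intro g x
  rw [hs]
  exact congrArg (fun i => (T i).act (s i) x) (one_mul g).symm

end IsTranslate

end Transducer

/-! ### The automaton of a finite group of transducers -/

/-- Weakly minimal, core, bi-synchronizing transducers representing a homomorphism to `Hn n`. -/
structure HnRepresentatives {n : ℕ} [NeZero n] {I : Type} [Group I] (ρ : I →* Hn n) where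
  T : I → Transducer n
  weaklyMinimal : ∀ i, (T i).WeaklyMinimal
  isCore : ∀ i, (T i).IsCore
  biSynchronizing : ∀ i, (T i).BiSynchronizing
  eq_minimalRep : ∀ i, ρ i = Hn.minimalRep (T i) (isCore i) (biSynchronizing i)

theorem HnRepresentatives.nonempty {n : ℕ} [NeZero n] {I : Type} [Group I] (ρ : I →* Hn n) :
    Nonempty (HnRepresentatives ρ) :=
  ⟨{ T := fun i => (Quotient.out (ρ i)).1
     weaklyMinimal := fun i => (Quotient.out (ρ i)).2.1
     isCore := fun i => (Quotient.out (ρ i)).2.2.1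
     biSynchronizing := fun i => (Quotient.out (ρ i)).2.2.2
     eq_minimalRep := fun i => (Quotient.out_eq (ρ i)).symm.trans (Hn.mk_eq_minimalRep _) }⟩

namespace HnRepresentatives

open Transducer

variable {n : ℕ} [NeZero n] {I : Type} [Group I] {ρ : I →* Hn n}

theorem invertible (R : HnRepresentatives ρ) (i : I) : (R.T i).Invertible :=
  (R.biSynchronizing i).choose

/-- The representative of the identity element is `ω`-equivalent, state by state, to the one-state
copier. -/
theorem act_one (R : HnRepresentatives ρ) (q : (R.T 1).Q) (x : ℕ → Fin n) :
    (R.T 1).act q x = x := by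
  have h : Hn.minimalRep (R.T 1) (R.isCore 1) (R.biSynchronizing 1) =
      Hn.minimalRep (identity n) identity_isCore identity_biSynchronizing :=
    (R.eq_minimalRep 1).symm.trans ρ.map_one
  obtain ⟨p, hp⟩ := Hn.exists_act_eq h q
  rw [hp, identity_act]

/-! ### The action of the group on the states and edges of the automaton -/

variable [Finite I]

/-- The core of the diagonal of the transducers representing the group elements. -/
abbrev automaton (R : HnRepresentatives ρ) : Automaton n :=
  (diagonal R.T).core.toAutomaton

theorem automaton_isCore (R : HnRepresentatives ρ) : R.automaton.IsCore :=
  core_isCore (diagonal_stronglySynchronizing fun i => (R.isCore i).1)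

/-- Take a long word `w` forcing `s`, and let `t` be the state forced by the output of `T h` on `w`
from `s h`. Some state of the product of `T h` and `T g` is `ω`-equivalent to `s (h * g)`; after `w`
it no longer matters which one, and the state reached is `(s h, t g)`. -/
theorem exists_isTranslate (R : HnRepresentatives ρ) (h : I) (s : R.automaton.Q) :
    ∃ t : R.automaton.Q, IsTranslate R.T h s.1 t.1 := by
  obtain ⟨l, hl⟩ := Automaton.exists_uniform_level fun g =>
    prod_stronglySynchronizing (R.isCore h).1 (R.isCore g).1
  obtain ⟨m, hm⟩ := diagonal_stronglySynchronizing fun i => (R.isCore i).1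
  -- Length at least `l` synchronizes every product of `T h` with some `T g`; length at least `m`
  -- makes the output word, which is as long as `w`, synchronize the diagonal, so that the witness
  -- lies in the core.
  obtain ⟨w, hw, hs⟩ := R.automaton_isCore.exists_long_run s (l + m)
  have hs' : (diagonal R.T).run w s.1 = s.1 :=
    (Automaton.map_run (A := R.automaton) (B := (diagonal R.T).toAutomaton) Subtype.val
      (fun _ _ => rfl) w s).symm.trans (congrArg _ (hs s))
  have hi (i : I) : (R.T i).run w (s.1 i) = s.1 i :=
    (diagonal_run R.T w s.1 i).symm.trans (congrFun hs' i)
  refine ⟨⟨(diagonal R.T).run ((R.T h).outWord w (s.1 h)) s.1,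
    Automaton.mem_coreStates_of_run (k := m) (fun v hv => hm.run_eq_of_le hv) ?_ _⟩,
    fun g x => ?_⟩
  · rw [length_outWord]; omega
  have hmul : Hn.minimalRep (R.T (h * g)) (R.isCore _) (R.biSynchronizing _) =
      Hn.minimalRep (R.T h) (R.isCore _) (R.biSynchronizing _) *
        Hn.minimalRep (R.T g) (R.isCore _) (R.biSynchronizing _) := by
    rw [← R.eq_minimalRep, ← R.eq_minimalRep, ← R.eq_minimalRep, map_mul]
  obtain ⟨p, hp⟩ := Hn.exists_prod_act_eq hmul (s.1 (h * g))
  have e1 := congrFun (act_run_eq hp w) x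
  -- Synchronization replaces the unknown state `p` by `(s h, s g)`. Reading `w` brings the first
  -- coordinate back to `s h` and takes the second to the coordinate `g` of the witness.
  rw [hi, hl g w (by omega) p (s.1 h, s.1 g), prod_run, prod_act, hi, ← diagonal_run] at e1
  exact e1.symm

/-- The action of a group element on the states. -/
def vert (R : HnRepresentatives ρ) (h : I) (s : R.automaton.Q) : R.automaton.Q :=
  (R.exists_isTranslate h s).choose

theorem isTranslate_vert (R : HnRepresentatives ρ) (h : I) (s : R.automaton.Q) :
    IsTranslate R.T h s.1 (R.vert h s).1 :=
  (R.exists_isTranslate h s).choose_spec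

/-- By uniqueness the choice in `vert` is harmless: each identity for the action reduces to
exhibiting a translate. -/
theorem vert_eq (R : HnRepresentatives ρ) {h : I} {s t : R.automaton.Q}
    (ht : IsTranslate R.T h s.1 t.1) : R.vert h s = t :=
  Subtype.ext ((R.isTranslate_vert h s).unique R.weaklyMinimal R.invertible ht)

theorem vert_one (R : HnRepresentatives ρ) (s : R.automaton.Q) : R.vert 1 s = s :=
  R.vert_eq (.one (R.act_one _))

theorem vert_vert (R : HnRepresentatives ρ) (h k : I) (s : R.automaton.Q) :
    R.vert k (R.vert h s) = R.vert (h * k) s :=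
  (R.vert_eq ((R.isTranslate_vert h s).trans (R.isTranslate_vert k _))).symm

theorem vert_step (R : HnRepresentatives ρ) (h : I) (a : Fin n) (s : R.automaton.Q) :
    R.automaton.step ((R.T h).out a (s.1 h)) (R.vert h s) = R.vert h (R.automaton.step a s) :=
  (R.vert_eq ((R.isTranslate_vert h s).step a)).symm

/-- The action of a group element on the edges. -/
def edge (R : HnRepresentatives ρ) (h : I) (e : R.automaton.digraph.E) :
    R.automaton.digraph.E :=
  ⟨(R.vert h e.1.1, (R.T h).out e.1.2.1 (e.1.1.1 h), R.vert h e.1.2.2), by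
    rw [← e.2]; exact R.vert_step h _ _⟩

theorem edge_one (R : HnRepresentatives ρ) (e : R.automaton.digraph.E) : R.edge 1 e = e :=
  Subtype.ext (Prod.ext (R.vert_one _)
    -- The label is fixed because it is the first output letter on a constant word, which `T 1`
    -- copies.
    (Prod.ext (congrFun (R.act_one _ fun _ => e.1.2.1) 0) (R.vert_one _)))

theorem edge_edge (R : HnRepresentatives ρ) (h k : I) (e : R.automaton.digraph.E) :
    R.edge k (R.edge h e) = R.edge (h * k) e :=
  Subtype.ext (Prod.ext (R.vert_vert h k _)
    (Prod.ext ((R.isTranslate_vert h _).out_eq k _) (R.vert_vert h k _)))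

/-- The automorphism of the underlying digraph given by a group element. -/
def automorphism (R : HnRepresentatives ρ) (h : I) : R.automaton.digraph.Automorphism where
  vert :=
    { toFun := R.vert h
      invFun := R.vert h⁻¹
      left_inv := fun s => by rw [vert_vert, mul_inv_cancel, vert_one]
      right_inv := fun s => by rw [vert_vert, inv_mul_cancel, vert_one] }
  edge :=
    { toFun := R.edge h
      invFun := R.edge h⁻¹
      left_inv := fun e => by rw [edge_edge, mul_inv_cancel, edge_one]
      right_inv := fun e => by rw [edge_edge, inv_mul_cancel, edge_one] }
  origin_edge _ := rfl
  terminus_edge _ := rfl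

/-- The action of the group on the underlying digraph. -/
def automorphismHom (R : HnRepresentatives ρ) : I →* R.automaton.digraph.Automorphism :=
  MonoidHom.mk' R.automorphism fun h k => DirectedGraph.Automorphism.ext
    (Equiv.ext fun s => (R.vert_vert h k s).symm) (Equiv.ext fun e => (R.edge_edge h k e).symm)

/-- The projection `t ↦ t h` commutes with transitions and preserves outputs, so `t` and `t h` are
`ω`-equivalent. One such pair suffices, as both transducers are core. -/
theorem eq_ofGraphAutomorphism (R : HnRepresentatives ρ) (h : I) :
    ρ h = Hn.ofGraphAutomorphism R.automaton R.automaton_isCore (R.automorphismHom h) := by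
  rw [R.eq_minimalRep]
  obtain ⟨s⟩ := R.automaton_isCore.1.nonempty
  refine Hn.minimalRep_eq (q := s.1 h) (p := s) (act_eq_of_bisim
    (U := R.automaton.glue (R.automorphismHom h))
    (fun (q : (R.T h).Q) (t : R.automaton.Q) => q = t.1 h) ?_ ?_ rfl)
  · rintro _ t rfl a; rfl
  · rintro _ t rfl a; rfl

end HnRepresentatives

end

/-! ### The theorem for a finite subgroup -/

theorem mainTheorem3 (n : ℕ) [Nat.AtLeastTwo n] (G : Subgroup (Hn n)) [Finite G] :
    ∃ (A : Automaton n) (_ : A.StronglySynchronizing) (hA : A.IsCore)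
      (K : Subgroup A.digraph.Automorphism) (e : G ≃* K),
      ∀ g : G, (g : Hn n) = Hn.ofGraphAutomorphism A hA (e g : A.digraph.Automorphism) := by
  -- `G` lies in `Type 1`, whereas the states of an automaton, here families indexed by the group,
  -- must form a `Type`. A finite group has a copy there.
  let σ : Shrink.{0} G ≃* G := Shrink.mulEquiv
  have : Finite (Shrink.{0} G) := .of_equiv G σ.symm.toEquiv
  obtain ⟨R⟩ := HnRepresentatives.nonempty (G.subtype.comp σ.toMonoidHom)
  -- An element of `G` is recovered from its automorphism as a minimal representative.
  have hinj : Function.Injective R.automorphismHom := fun h k hk => σ.injective (Subtype.ext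
    ((R.eq_ofGraphAutomorphism h).trans (hk ▸ (R.eq_ofGraphAutomorphism k).symm)))
  refine ⟨R.automaton, R.automaton_isCore.1, R.automaton_isCore, R.automorphismHom.range,
    σ.symm.trans (MonoidHom.ofInjective hinj), fun g => ?_⟩
  exact (congrArg Subtype.val (σ.apply_symm_apply g)).symm.trans
    (R.eq_ofGraphAutomorphism (σ.symm g))
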